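/- Let $n\in\mathbb{N}$, let $S\subset\mathbb{F}_2^n$ with $|S|\ge 2$, let $0<\delta\le 1/10$ and $\tau>1$ be real numbers, and put $m=\log_2\bigl(|S|(|S|-1)/\delta\bigr)$ (a real number). Suppose that $$|S|>m^4\max\left(\frac{2^8(1+\tau)^4}{((\tau-\sqrt{\tau})\delta)^8},\,1\right)$$ and $$m\ge 20\left\lceil\log_2\left(m\max\left(\frac{4(1+\tau)}{((\tau-\sqrt{\tau})\delta)^2},\,1\right)\right)\right\rceil .$$ Then there exists a natural number $t\le n$ with $$t\ge \log_2|S|-4\log_2\left(m\max\left(\frac{4(1+\tau)}{(\tau-\sqrt{\tau})^2\delta^2},\,1\right)\right)$$ such that at least a $(1-\delta)$-fraction of all surjective linear maps $L:\mathbb{F}_2^n\to\mathbb{F}_2^t$ have the property that $L(U_S)$, where $U_S$ is uniformly distributed on $S$, is $\tau 2^{-t}$-close to uniform in the $\ell_\infty$ norm, i.e. $\left|\Pr[L(U_S)=y]-2^{-t}\right|\le \tau 2^{-t}$ for every $y\in\mathbb{F}_2^t$. -/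

import Mathlib

/-- The distribution of `L(U_S)`, where `U_S` is uniformly distributed on the nonempty finite
set `S`. -/
noncomputable def hashedUniform {α β : Type*} (S : Finset α) (hS : S.Nonempty) (L : α → β) :
    PMF β :=
  (PMF.uniformOfFinset S hS).map L

/-- A probability distribution on a finite type is `ε`-close to uniform in the `ℓ_∞` norm. -/
def CloseToUniform {β : Type*} [Fintype β] [Nonempty β] (p : PMF β) (ε : ℝ) : Prop :=
  ∀ y : β, |(p y).toReal - (PMF.uniformOfFintype β y).toReal| ≤ ε

/-- The set of surjective linear maps from `F_2^n` to `F_2^t`. -/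
def surjectiveMaps (n t : ℕ) : Set ((Fin n → ZMod 2) →ₗ[ZMod 2] (Fin t → ZMod 2)) :=
  {L | Function.Surjective L}

/-- At least a `c`-fraction of the elements of `A` satisfy `P` (meant for finite nonempty `A`). -/
def HoldsForFraction {α : Type*} (c : ℝ) (A : Set α) (P : α → Prop) : Prop :=
  c * (A.ncard : ℝ) ≤ (({a ∈ A | P a} : Set α).ncard : ℝ)

/-! Since `τ > 1`, the lower bound on each probability is automatic, so only the maximal load
matters: most `L` must put at most `K = (1 + τ)|S| / 2^t` elements of `S` in every bucket.

Chebyshev plus a union bound over buckets is too weak. Instead `L` is extended by a random `R` into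
`F_2^s` with `t + s ≤ 2^s`. If a bucket of `L` is overloaded, then at least half of the `R` spread
it so evenly that all `2^s` points above it are heavy for `L.prod R` (`card_overloaded_mul_le`).
Thus the set `B` of heavy points contains a whole coset of `F_2^s`. But Chebyshev makes `B` sparse
on average, and a sparse set rarely contains a random `s`-dimensional cube: the probability is at
most `c` times the density of `B` once `c ^ 2 ^ s` reaches the size of the space
(`card_containsCube_mul_le`). Composing with a random automorphism turns the fixed coset into such a
random cube (`card_heavy_coset_mul_le`).

Together these bound the proportion of overloaded `L` by `16|S| / (2^t 2^s d^2)`, where `d` is the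
excess of a heavy point over the mean. Surjective maps are at least half of all maps, so restricting
to them costs a factor 2. -/

open Finset Classical in
/-- The number of elements of `A` that `H` sends to `x`. -/
noncomputable def load {α β : Type*} (H : α → β) (A : Finset α) (x : β) : ℝ :=
  ((A.filter fun a => H a = x).card : ℝ)

/-! ### Second moments of the loads -/

section SecondMoment

open Finset Classical

lemma load_nonneg {α β : Type*} (H : α → β) (A : Finset α) (x : β) : 0 ≤ load H A x :=
  Nat.cast_nonneg _

lemma sum_load {α β : Type*} [Fintype β] (H : α → β) (A : Finset α) :
    ∑ x, load H A x = A.card := by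
  unfold load
  rw [card_eq_sum_card_fiberwise (f := H) (t := univ) (fun _ _ => mem_coe.2 (mem_univ _))]
  push_cast
  rfl

lemma sum_load_sq {α β : Type*} [Fintype β] (H : α → β) (A : Finset α) :
    ∑ x, load H A x ^ 2 = ∑ a ∈ A, ∑ b ∈ A, if H a = H b then (1 : ℝ) else 0 := by
  have h : ∀ x, load H A x ^ 2 =
      ∑ a ∈ A, ∑ b ∈ A, if H a = x ∧ H b = x then (1 : ℝ) else 0 := by
    intro x
    have h1 : load H A x = ∑ a ∈ A, if H a = x then (1 : ℝ) else 0 := by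
      simp [load]
    rw [sq, h1, sum_mul_sum]
    refine sum_congr rfl fun a _ => sum_congr rfl fun b _ => ?_
    by_cases h2 : H a = x <;> by_cases h3 : H b = x <;> simp [h2, h3]
  rw [sum_congr rfl fun x _ => h x, sum_comm]
  refine sum_congr rfl fun a _ => ?_
  rw [sum_comm]
  refine sum_congr rfl fun b _ => ?_
  by_cases hab : H a = H b
  · simp [hab]
  · rw [if_neg hab]
    exact sum_eq_zero fun x _ => if_neg fun hx => hab (hx.1.trans hx.2.symm)

/-- For a universal family of functions, the loads have the variance of a pairwise independent
family. -/
lemma sum_sum_load_sub_sq_le {Ω α β : Type*} [Fintype Ω] [Fintype β] [Nonempty β]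
    (H : Ω → α → β) (A : Finset α)
    (hH : ∀ a ∈ A, ∀ b ∈ A, a ≠ b →
      (Fintype.card β : ℝ) * ((univ.filter fun ω => H ω a = H ω b).card : ℝ) ≤ Fintype.card Ω) :
    ∑ ω, ∑ x, (load (H ω) A x - (A.card : ℝ) / Fintype.card β) ^ 2
      ≤ Fintype.card Ω * A.card := by
  have hβ : (0 : ℝ) < Fintype.card β := by exact_mod_cast Fintype.card_pos
  have h1 : ∀ ω, ∑ x, (load (H ω) A x - (A.card : ℝ) / Fintype.card β) ^ 2 =
      (∑ a ∈ A, ∑ b ∈ A, if H ω a = H ω b then (1 : ℝ) else 0)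
        - (A.card : ℝ) ^ 2 / Fintype.card β := by
    intro ω
    rw [← sum_load_sq]
    have h2 : ∀ x, (load (H ω) A x - (A.card : ℝ) / Fintype.card β) ^ 2 =
        load (H ω) A x ^ 2 - 2 * ((A.card : ℝ) / Fintype.card β) * load (H ω) A x
          + ((A.card : ℝ) / Fintype.card β) ^ 2 := fun x => by ring
    rw [sum_congr rfl fun x _ => h2 x, sum_add_distrib, sum_sub_distrib, ← mul_sum, sum_load,
      sum_const, card_univ, nsmul_eq_mul]
    field_simp
    ring
  rw [sum_congr rfl fun ω _ => h1 ω, sum_sub_distrib, sum_const, card_univ, nsmul_eq_mul, sum_comm]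
  have h3 : ∀ a ∈ A, (∑ ω, ∑ b ∈ A, if H ω a = H ω b then (1 : ℝ) else 0) ≤
      Fintype.card Ω + A.card * (Fintype.card Ω / Fintype.card β) := by
    intro a ha
    rw [sum_comm]
    have h4 : ∀ b ∈ A, (∑ ω, if H ω a = H ω b then (1 : ℝ) else 0) ≤
        (if a = b then (Fintype.card Ω : ℝ) else 0) + Fintype.card Ω / Fintype.card β := by
      intro b hb
      by_cases hab : a = b
      · subst hab
        simp only [if_true, sum_const, card_univ, nsmul_eq_mul, mul_one]
        exact le_add_of_nonneg_right (by positivity)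
      · rw [if_neg hab, zero_add, le_div_iff₀ hβ, mul_comm]
        refine le_trans (le_of_eq ?_) (hH a ha b hb hab)
        simp
    refine (sum_le_sum h4).trans (le_of_eq ?_)
    rw [sum_add_distrib, sum_ite_eq, if_pos ha, sum_const, nsmul_eq_mul]
  have h5 := sum_le_sum h3
  rw [sum_const, nsmul_eq_mul] at h5
  refine (sub_le_sub_right h5 _).trans (le_of_eq ?_)
  field_simp
  ring

/-- Chebyshev's inequality for the loads of a universal family. -/
lemma sum_card_deviating_mul_sq_le {Ω α β : Type*} [Fintype Ω] [Fintype β] [Nonempty β]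
    (H : Ω → α → β) (A : Finset α)
    (hH : ∀ a ∈ A, ∀ b ∈ A, a ≠ b →
      (Fintype.card β : ℝ) * ((univ.filter fun ω => H ω a = H ω b).card : ℝ) ≤ Fintype.card Ω)
    (d : ℝ) :
    (∑ ω, ((univ.filter fun x =>
        d ^ 2 ≤ (load (H ω) A x - (A.card : ℝ) / Fintype.card β) ^ 2).card : ℝ)) * d ^ 2
      ≤ Fintype.card Ω * A.card := by
  refine le_trans ?_ (sum_sum_load_sub_sq_le H A hH)
  rw [sum_mul]
  refine sum_le_sum fun ω _ => ?_
  rw [← nsmul_eq_mul, ← sum_const]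
  refine (sum_le_sum fun x hx => (mem_filter.1 hx).2).trans ?_
  exact sum_le_sum_of_subset_of_nonneg (filter_subset _ _) fun _ _ _ => sq_nonneg _

end SecondMoment

/-! ### Cubes in sparse sets -/

section Cubes

open Finset Classical

/-- The set `B` contains a translate of the span of `v`. -/
def ContainsCube {W : Type*} [AddCommGroup W] [Module (ZMod 2) W] {s : ℕ} (B : Finset W)
    (v : Fin s → W) : Prop :=
  ∃ x, ∀ e : Fin s → ZMod 2, x + ∑ i, e i • v i ∈ B

/-- A cube with a direction `w` is a smaller cube together with its translate by `w`; this drives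
the induction on dimension. -/
lemma ContainsCube.of_cons {W : Type*} [AddCommGroup W] [Module (ZMod 2) W] {s : ℕ}
    {B : Finset W} {w : W} {v : Fin s → W} (h : ContainsCube B (Fin.cons w v : Fin (s + 1) → W)) :
    ContainsCube (B.filter fun x => x + w ∈ B) v := by
  obtain ⟨x, hx⟩ := h
  refine ⟨x, fun e => mem_filter.2 ⟨?_, ?_⟩⟩
  · simpa [Fin.sum_univ_succ] using hx (Fin.cons 0 e)
  · have := hx (Fin.cons 1 e)
    simp only [Fin.sum_univ_succ, Fin.cons_zero, Fin.cons_succ, one_smul] at this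
    rwa [add_comm w, ← add_assoc] at this

lemma sum_card_inter_translate {W : Type*} [AddCommGroup W] [Fintype W] (B : Finset W) :
    ∑ w, ((B.filter fun x => x + w ∈ B).card : ℝ) = (B.card : ℝ) ^ 2 := by
  have h : ∀ w, ((B.filter fun x => x + w ∈ B).card : ℝ) =
      ∑ x ∈ B, if x + w ∈ B then (1 : ℝ) else 0 := fun w => by simp
  rw [sum_congr rfl fun w _ => h w, sum_comm]
  have h2 : ∀ x ∈ B, (∑ w, if x + w ∈ B then (1 : ℝ) else 0) = B.card := by
    intro x _
    rw [Fintype.sum_equiv (Equiv.addLeft x) (fun w => if x + w ∈ B then (1 : ℝ) else 0)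
      (fun y => if y ∈ B then (1 : ℝ) else 0) fun _ => rfl]
    simp
  rw [sum_congr rfl h2, sum_const, nsmul_eq_mul, sq]

/-- A sparse set contains few cubes of logarithmic dimension. -/
lemma card_containsCube_mul_le {W : Type*} [AddCommGroup W] [Module (ZMod 2) W] [Fintype W]
    (s : ℕ) : ∀ (c : ℝ), 0 ≤ c → (Fintype.card W : ℝ) ≤ c ^ 2 ^ s → ∀ B : Finset W,
    ((univ.filter fun v : Fin s → W => ContainsCube B v).card : ℝ) * Fintype.card W
      ≤ (Fintype.card W : ℝ) ^ s * c * B.card := by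
  induction s with
  | zero =>
    intro c _ hW B
    rw [pow_zero, pow_one] at hW
    rcases B.eq_empty_or_nonempty with rfl | hB
    · simp [ContainsCube]
    · have h1 : ((univ.filter fun v : Fin 0 → W => ContainsCube B v).card : ℝ) ≤ 1 := by
        exact_mod_cast (card_filter_le _ _).trans (by simp)
      have h2 : (1 : ℝ) ≤ B.card := by exact_mod_cast hB.card_pos
      rw [pow_zero, one_mul]
      refine mul_le_mul_of_nonneg_right h1 (Nat.cast_nonneg _) |>.trans ?_
      nlinarith
  | succ s ih =>
    intro c hc hW B
    set N : ℝ := (Fintype.card W : ℝ) with hN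
    have hN0 : 0 < N := by
      rw [hN]; exact_mod_cast Fintype.card_pos
    rcases B.eq_empty_or_nonempty with rfl | hB
    · simp [ContainsCube]
    have hb : (0 : ℝ) < B.card := by exact_mod_cast hB.card_pos
    set b : ℝ := (B.card : ℝ)
    have hcard : ((univ.filter fun v : Fin (s + 1) → W => ContainsCube B v).card : ℝ) ≤
        ∑ w, ((univ.filter fun v : Fin s → W =>
          ContainsCube (B.filter fun x => x + w ∈ B) v).card : ℝ) := by
      rw [← Nat.cast_sum, ← card_sigma]
      refine Nat.cast_le.2 (card_le_card_of_injOn (fun v => ⟨v 0, Fin.tail v⟩) ?_ ?_)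
      · intro v hv
        simp only [coe_filter, mem_univ, true_and, Set.mem_ofPred_eq] at hv
        simp only [coe_sigma, Set.mem_sigma_iff, coe_univ, Set.mem_univ, true_and, coe_filter,
          mem_univ, Set.mem_ofPred_eq]
        rw [← Fin.cons_self_tail v] at hv
        exact hv.of_cons
      · intro v _ v' _ h
        simp only [Sigma.mk.injEq, heq_eq_eq] at h
        rw [← Fin.cons_self_tail v, ← Fin.cons_self_tail v', h.1, h.2]
    have hstep : ∀ w, ((univ.filter fun v : Fin s → W =>
          ContainsCube (B.filter fun x => x + w ∈ B) v).card : ℝ) ≤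
        N ^ s * (c / 2 * (((B.filter fun x => x + w ∈ B).card : ℝ) / b + b / N)) := by
      intro w
      set p : ℝ := ((univ.filter fun v : Fin s → W =>
          ContainsCube (B.filter fun x => x + w ∈ B) v).card : ℝ)
      set d : ℝ := ((B.filter fun x => x + w ∈ B).card : ℝ)
      have hd : 0 ≤ d := Nat.cast_nonneg _
      have hp : 0 ≤ p := Nat.cast_nonneg _
      -- The intersection is much sparser than `B` for typical `w`, so the induction can afford the
      -- constant `c ^ 2`, which also absorbs one doubling of the exponent `2 ^ s`.
      have h1 : p * N ≤ N ^ s * c ^ 2 * d :=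
        ih (c ^ 2) (sq_nonneg c) (by rw [← pow_mul, ← pow_succ']; exact hW) _
      have h2 : p ≤ N ^ s := by
        have : p ≤ (Fintype.card (Fin s → W) : ℝ) := Nat.cast_le.2 (card_le_univ _)
        simpa using this
      have hNs : 0 < N ^ s := pow_pos hN0 s
      -- Multiplying the trivial bound `h2` by `h1` gives `p ≤ N^s c √(d/N)`; AM-GM in the form
      -- `2√(d/N) ≤ d/b + b/N` makes this linear in `d`, so it can be summed over `w`.
      refine abs_le_of_sq_le_sq' ?_ (by positivity) |>.2
      have h3 : p ^ 2 ≤ N ^ s * (N ^ s * c ^ 2 * (d / N)) := by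
        rw [sq]
        refine mul_le_mul h2 ?_ hp hNs.le
        rw [← mul_div_assoc, le_div_iff₀ hN0]
        exact h1
      refine h3.trans ?_
      have h4 : (d / b + b / N) ^ 2 - 4 * (d / N) = (d / b - b / N) ^ 2 := by
        field_simp
        ring
      have h5 : 4 * (d / N) ≤ (d / b + b / N) ^ 2 := by nlinarith [sq_nonneg (d / b - b / N)]
      calc N ^ s * (N ^ s * c ^ 2 * (d / N)) = (N ^ s * c / 2) ^ 2 * (4 * (d / N)) := by ring
        _ ≤ (N ^ s * c / 2) ^ 2 * (d / b + b / N) ^ 2 := by gcongr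
        _ = _ := by ring
    -- As the `d` sum to `b ^ 2`, the terms `d/b` and `b/N` each contribute `b` in total, which
    -- restores the constant `c`.
    have hsum := hcard.trans (sum_le_sum fun w _ => hstep w)
    rw [← mul_sum, ← mul_sum, sum_add_distrib, ← sum_div, sum_card_inter_translate, sum_const,
      card_univ, nsmul_eq_mul] at hsum
    refine (mul_le_mul_of_nonneg_right hsum hN0.le).trans (le_of_eq ?_)
    change N ^ s * (c / 2 * (b ^ 2 / b + N * (b / N))) * N = N ^ (s + 1) * c * b
    field_simp
    ring

end Cubes

/-! ### Counting linear maps and automorphisms -/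

section LinearFamilies

open Finset Classical

/-- All fibres of a surjective homomorphism have the same size, so pulling back preserves density.
-/
lemma card_filter_comp_mul_card {G H : Type*} [AddGroup G] [AddGroup H] [Fintype G] [Fintype H]
    (f : G →+ H) (hf : Function.Surjective f) (P : H → Prop) :
    (univ.filter fun g => P (f g)).card * Fintype.card H
      = (univ.filter P).card * Fintype.card G := by
  have hfib : ∀ y, (univ.filter fun g => f g = y).card = (univ.filter fun g => f g = 0).card :=
    fun y => AddMonoidHom.card_fiber_eq_of_mem_range f (hf y) (hf 0)
  have h1 : Fintype.card G = Fintype.card H * (univ.filter fun g => f g = 0).card := by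
    rw [← card_univ, card_eq_sum_card_fiberwise (f := f) (t := univ)
      (fun _ _ => mem_coe.2 (mem_univ _)), sum_congr rfl fun y _ => hfib y, sum_const, card_univ,
      smul_eq_mul]
  have h2 : (univ.filter fun g => P (f g)).card =
      (univ.filter P).card * (univ.filter fun g => f g = 0).card := by
    rw [card_eq_sum_card_fiberwise (s := univ.filter fun g => P (f g)) (f := f)
      (t := univ.filter P) (fun g hg => by simpa using hg), ← smul_eq_mul, ← sum_const]
    refine sum_congr rfl fun y hy => ?_
    rw [← hfib y, filter_filter]
    congr 1
    ext g
    simp only [mem_filter, mem_univ, true_and] at hy ⊢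
    exact ⟨fun h => h.2, fun h => ⟨h ▸ hy, h⟩⟩
  rw [h2, h1]
  ring

lemma card_filter_eq_zero_mul_card {G H : Type*} [AddGroup G] [AddGroup H] [Fintype G] [Fintype H]
    (f : G →+ H) (hf : Function.Surjective f) :
    (univ.filter fun g => f g = 0).card * Fintype.card H = Fintype.card G := by
  rw [card_filter_comp_mul_card f hf fun y => y = 0, card_eq_one.2 ⟨0, by ext; simp⟩, one_mul]

variable {V X : Type*} [AddCommGroup V] [AddCommGroup X]
  [Module (ZMod 2) V] [Module (ZMod 2) X]

/-- The linear maps form a universal family. -/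
lemma card_mul_card_linearMap_collision [Fintype X] [Fintype (V →ₗ[ZMod 2] X)] {a b : V}
    (hab : a ≠ b) :
    Fintype.card X * (univ.filter fun L : V →ₗ[ZMod 2] X => L a = L b).card
      = Fintype.card (V →ₗ[ZMod 2] X) := by
  -- Collisions are the kernel of evaluation at `a - b`, which has index `|X|` because evaluation at
  -- a nonzero vector is onto.
  have hsurj : Function.Surjective (LinearMap.applyₗ (R := ZMod 2) (M₂ := X) (a - b)) := by
    intro y
    obtain ⟨φ, hφ⟩ : ∃ φ : Module.Dual (ZMod 2) V, φ (a - b) ≠ 0 := by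
      by_contra! h
      exact sub_ne_zero.2 hab ((Module.forall_dual_apply_eq_zero_iff (ZMod 2) _).1 h)
    refine ⟨φ.smulRight ((φ (a - b))⁻¹ • y), ?_⟩
    simp only [LinearMap.applyₗ_apply_apply, LinearMap.smulRight_apply, smul_smul]
    rw [mul_inv_cancel₀ hφ, one_smul]
  have h := card_filter_eq_zero_mul_card
    (LinearMap.applyₗ (R := ZMod 2) (M₂ := X) (a - b)).toAddMonoidHom hsurj
  rw [← h, mul_comm]
  congr 3
  ext L
  simp [sub_eq_zero]

lemma card_linearMap_collision_le [Fintype X] [Fintype (V →ₗ[ZMod 2] X)] (A : Finset V) :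
    ∀ a ∈ A, ∀ b ∈ A, a ≠ b →
      (Fintype.card X : ℝ) * ((univ.filter fun L : V →ₗ[ZMod 2] X => L a = L b).card : ℝ)
        ≤ Fintype.card (V →ₗ[ZMod 2] X) :=
  fun _ _ _ _ hab => le_of_eq (by exact_mod_cast card_mul_card_linearMap_collision hab)

lemma card_dual [Fintype V] [Fintype (Module.Dual (ZMod 2) V)] :
    Fintype.card (Module.Dual (ZMod 2) V) = Fintype.card V := by
  rw [Module.card_eq_pow_finrank (K := ZMod 2) (V := V),
    Module.card_eq_pow_finrank (K := ZMod 2) (V := Module.Dual (ZMod 2) V),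
    Subspace.dual_finrank_eq]

/-- Most linear maps to a smaller space are surjective. -/
lemma card_not_surjective_mul_card_le [Fintype V] [Fintype X] [Fintype (V →ₗ[ZMod 2] X)] :
    (univ.filter fun L : V →ₗ[ZMod 2] X => ¬ Function.Surjective L).card * Fintype.card V
      ≤ Fintype.card X * Fintype.card (V →ₗ[ZMod 2] X) := by
  have : Finite (Module.Dual (ZMod 2) V) := DFunLike.finite _
  have : Finite (Module.Dual (ZMod 2) X) := DFunLike.finite _
  have := Fintype.ofFinite (Module.Dual (ZMod 2) V)
  have := Fintype.ofFinite (Module.Dual (ZMod 2) X)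
  have hker : ∀ φ ∈ univ.filter (fun φ : Module.Dual (ZMod 2) X => φ ≠ 0),
      (univ.filter fun L : V →ₗ[ZMod 2] X => φ ∘ₗ L = 0).card * Fintype.card V
        = Fintype.card (V →ₗ[ZMod 2] X) := by
    intro φ hφ
    have hφ0 : φ ≠ 0 := (mem_filter.1 hφ).2
    obtain ⟨x, hx⟩ : ∃ x, φ x ≠ 0 := by
      by_contra! h
      exact hφ0 (LinearMap.ext h)
    have hsurj : Function.Surjective (LinearMap.compRight (ZMod 2) (M := V) φ) := by
      intro ψ
      refine ⟨ψ.smulRight ((φ x)⁻¹ • x), ?_⟩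
      ext v
      simp [hx]
    have h := card_filter_eq_zero_mul_card
      (LinearMap.compRight (ZMod 2) (M := V) φ).toAddMonoidHom hsurj
    rw [← h]
    refine congr_arg₂ (· * ·) ?_ (card_dual (V := V)).symm
    congr
  -- A proper range lies in the kernel of some nonzero functional; a union bound over functionals
  -- follows.
  have hsub : (univ.filter fun L : V →ₗ[ZMod 2] X => ¬ Function.Surjective L) ⊆
      (univ.filter (fun φ : Module.Dual (ZMod 2) X => φ ≠ 0)).biUnion
        fun φ => univ.filter fun L : V →ₗ[ZMod 2] X => φ ∘ₗ L = 0 := by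
    intro L hL
    have hL' : LinearMap.range L < ⊤ := by
      rw [lt_top_iff_ne_top, Ne, LinearMap.range_eq_top]
      exact (mem_filter.1 hL).2
    obtain ⟨φ, hφ, hle⟩ := Submodule.exists_le_ker_of_lt_top _ hL'
    simp only [mem_biUnion, mem_filter, mem_univ, true_and]
    exact ⟨φ, hφ, LinearMap.range_le_ker_iff.1 hle⟩
  calc _ ≤ (∑ φ ∈ univ.filter (fun φ : Module.Dual (ZMod 2) X => φ ≠ 0),
        (univ.filter fun L : V →ₗ[ZMod 2] X => φ ∘ₗ L = 0).card) * Fintype.card V :=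
        Nat.mul_le_mul_right _ ((card_le_card hsub).trans card_biUnion_le)
    _ = (univ.filter (fun φ : Module.Dual (ZMod 2) X => φ ≠ 0)).card
          * Fintype.card (V →ₗ[ZMod 2] X) := by
        rw [sum_mul, sum_congr rfl hker, sum_const, smul_eq_mul]
    _ ≤ _ := by
        refine Nat.mul_le_mul_right _ ((card_le_univ _).trans (le_of_eq ?_))
        exact card_dual

/-- The extra term `(1 / 2) ^ (k + 2)` is the slack that lets the induction close; only the bound `1
/ 4` is needed. -/
lemma prod_one_sub_two_pow_ge (k : ℕ) :
    (1 : ℝ) / 4 + (1 / 2) ^ (k + 2) ≤ ∏ i ∈ range (k + 1), (1 - (1 / 2 : ℝ) ^ (i + 1)) := by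
  induction k with
  | zero => norm_num
  | succ k ih =>
    rw [prod_range_succ]
    have h0 : (0 : ℝ) < (1 / 2) ^ k := by positivity
    have h1 : (1 / 2 : ℝ) ^ k ≤ 1 := pow_le_one₀ (by norm_num) (by norm_num)
    have h2 : (0 : ℝ) ≤ 1 - (1 / 2) ^ (k + 1 + 1) := by
      rw [pow_succ, pow_succ]; linarith
    refine le_trans ?_ (mul_le_mul_of_nonneg_right ih h2)
    simp only [pow_succ]
    nlinarith

lemma two_pow_sq_le_card_GL (u : ℕ) :
    (2 : ℝ) ^ (u * u) ≤ 4 * Nat.card (GL (Fin u) (ZMod 2)) := by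
  rw [Matrix.card_GL_field, ZMod.card, Fin.prod_univ_eq_prod_range (fun i => 2 ^ u - 2 ^ i) u]
  have h1 : ((∏ i ∈ range u, (2 ^ u - 2 ^ i) : ℕ) : ℝ) =
      2 ^ (u * u) * ∏ i ∈ range u, (1 - (1 / 2 : ℝ) ^ (i + 1)) := by
    have h2 : (2 : ℝ) ^ (u * u) = ∏ _i ∈ range u, 2 ^ u := by
      rw [prod_const, card_range, pow_mul]
    rw [← prod_range_reflect, h2, ← prod_mul_distrib, Nat.cast_prod]
    refine prod_congr rfl fun i hi => ?_
    have hi' : i + 1 ≤ u := mem_range.1 hi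
    have h3 : u - 1 - i = u - (i + 1) := by omega
    rw [h3, Nat.cast_sub (Nat.pow_le_pow_right (by norm_num) (Nat.sub_le _ _))]
    push_cast
    rw [mul_sub, mul_one, one_div, inv_pow, ← div_eq_mul_inv,
      pow_sub₀ (2 : ℝ) two_ne_zero hi', div_eq_mul_inv]
  rw [h1]
  have h2 : (1 : ℝ) / 4 ≤ ∏ i ∈ range u, (1 - (1 / 2 : ℝ) ^ (i + 1)) := by
    cases u with
    | zero => norm_num
    | succ k =>
      exact le_trans (le_add_of_nonneg_right (by positivity)) (prod_one_sub_two_pow_ge k)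
  have h3 : (0 : ℝ) < 2 ^ (u * u) := by positivity
  nlinarith

/-- A constant fraction of the endomorphisms are invertible. -/
lemma card_end_le_four_mul_card_equiv [Fintype X] [Fintype (X →ₗ[ZMod 2] X)]
    [Fintype (X ≃ₗ[ZMod 2] X)] :
    (Fintype.card (X →ₗ[ZMod 2] X) : ℝ) ≤ 4 * Fintype.card (X ≃ₗ[ZMod 2] X) := by
  have h1 : Fintype.card (X →ₗ[ZMod 2] X) =
      2 ^ (Module.finrank (ZMod 2) X * Module.finrank (ZMod 2) X) := by
    rw [Module.card_eq_pow_finrank (K := ZMod 2), ZMod.card,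
      Module.finrank_linearMap]
  have e : GL (Fin (Module.finrank (ZMod 2) X)) (ZMod 2) ≃ (X ≃ₗ[ZMod 2] X) :=
    (Matrix.GeneralLinearGroup.toLin.trans ((LinearMap.GeneralLinearGroup.congrLinearEquiv
      (Module.finBasis (ZMod 2) X).equivFun.symm).trans
        (LinearMap.GeneralLinearGroup.generalLinearEquiv (ZMod 2) X))).toEquiv
  rw [h1, ← Nat.card_eq_fintype_card, ← Nat.card_congr e]
  exact_mod_cast two_pow_sq_le_card_GL (Module.finrank (ZMod 2) X)

/-- For most automorphisms `g` the set `g '' B` contains no translate of the second factor. -/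
lemma card_equiv_coset_subset_mul_le [Fintype X] (s : ℕ)
    [Fintype ((X × (Fin s → ZMod 2)) ≃ₗ[ZMod 2] (X × (Fin s → ZMod 2)))] (c : ℝ) (hc : 0 ≤ c)
    (hcard : (Fintype.card (X × (Fin s → ZMod 2)) : ℝ) ≤ c ^ 2 ^ s)
    (B : Finset (X × (Fin s → ZMod 2))) :
    ((univ.filter fun g : (X × (Fin s → ZMod 2)) ≃ₗ[ZMod 2] (X × (Fin s → ZMod 2)) =>
        ∃ x, ∀ y, g.symm (x, y) ∈ B).card : ℝ) * Fintype.card (X × (Fin s → ZMod 2))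
      ≤ 4 * c * Fintype.card ((X × (Fin s → ZMod 2)) ≃ₗ[ZMod 2] (X × (Fin s → ZMod 2)))
        * B.card := by
  have : Finite ((X × (Fin s → ZMod 2)) →ₗ[ZMod 2] (X × (Fin s → ZMod 2))) := DFunLike.finite _
  have := Fintype.ofFinite ((X × (Fin s → ZMod 2)) →ₗ[ZMod 2] (X × (Fin s → ZMod 2)))
  -- The images of the standard basis of the second factor: for uniform `h` they are uniform and
  -- independent, and they are the directions of the cube that is the image of a coset.
  let f : ((X × (Fin s → ZMod 2)) →ₗ[ZMod 2] (X × (Fin s → ZMod 2))) →+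
      (Fin s → X × (Fin s → ZMod 2)) :=
    { toFun := fun h i => h (0, Pi.single i 1)
      map_zero' := rfl
      map_add' := fun _ _ => rfl }
  have hf : Function.Surjective f := by
    intro v
    refine ⟨(Fintype.linearCombination (ZMod 2) v) ∘ₗ LinearMap.snd _ _ _, ?_⟩
    funext i
    simp [f, Fintype.linearCombination_apply_single]
  have h1 : (univ.filter fun g : (X × (Fin s → ZMod 2)) ≃ₗ[ZMod 2] (X × (Fin s → ZMod 2)) =>
        ∃ x, ∀ y, g.symm (x, y) ∈ B).card ≤
      (univ.filter fun h => ContainsCube B (f h)).card := by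
    refine card_le_card_of_injOn (fun g => g.symm.toLinearMap) ?_ ?_
    · intro g hg
      simp only [coe_filter, mem_univ, true_and, Set.mem_ofPred_eq] at hg ⊢
      obtain ⟨x, hx⟩ := hg
      refine ⟨g.symm (x, 0), fun e => ?_⟩
      have h2 : ((x, e) : X × (Fin s → ZMod 2)) =
          (x, 0) + ∑ i, e i • ((0 : X), (Pi.single i 1 : Fin s → ZMod 2)) := by
        refine Prod.ext ?_ ?_
        · simp [Prod.fst_sum]
        · rw [Prod.snd_add, Prod.snd_sum, zero_add]
          exact (pi_eq_sum_univ' e)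
      have h3 := hx e
      rw [h2, map_add, map_sum] at h3
      simp only [map_smul] at h3
      exact h3
    · intro g _ g' _ h
      exact LinearEquiv.symm_bijective.injective (LinearEquiv.toLinearMap_injective h)
  have h2 := card_filter_comp_mul_card f hf (ContainsCube B)
  have h3 := card_containsCube_mul_le s c hc hcard B
  -- Passing from automorphisms to all endomorphisms loses only the factor 4.
  have h4 := card_end_le_four_mul_card_equiv (X := X × (Fin s → ZMod 2))
  have hcf : Fintype.card (Fin s → X × (Fin s → ZMod 2)) =
      Fintype.card (X × (Fin s → ZMod 2)) ^ s := by simp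
  rw [hcf] at h2
  have h2' : ((univ.filter fun h => ContainsCube B (f h)).card : ℝ) *
      (Fintype.card (X × (Fin s → ZMod 2)) : ℝ) ^ s =
      ((univ.filter (ContainsCube (s := s) B)).card : ℝ) *
        Fintype.card ((X × (Fin s → ZMod 2)) →ₗ[ZMod 2] (X × (Fin s → ZMod 2))) := by
    exact_mod_cast h2
  have h1' := (Nat.cast_le (α := ℝ)).2 h1
  have hW : (0 : ℝ) < Fintype.card (X × (Fin s → ZMod 2)) := by
    exact_mod_cast Fintype.card_pos
  set W : ℝ := (Fintype.card (X × (Fin s → ZMod 2)) : ℝ)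
  set E : ℝ := (Fintype.card ((X × (Fin s → ZMod 2)) →ₗ[ZMod 2] (X × (Fin s → ZMod 2))) : ℝ)
  have hWs : 0 < W ^ s := pow_pos hW s
  refine le_of_mul_le_mul_right ?_ hWs
  calc _ ≤ ((univ.filter fun h => ContainsCube B (f h)).card : ℝ) * W * W ^ s := by gcongr
    _ = ((univ.filter (ContainsCube (s := s) B)).card : ℝ) * W * E := by
        rw [mul_right_comm, h2']; ring
    _ ≤ W ^ s * c * B.card * E := by gcongr
    _ ≤ W ^ s * c * B.card *
        (4 * Fintype.card ((X × (Fin s → ZMod 2)) ≃ₗ[ZMod 2] (X × (Fin s → ZMod 2)))) := by gcongr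
    _ = _ := by ring

end LinearFamilies

/-! ### The maximal load of a random linear map -/

section MaximalLoad

open Finset Classical

variable {V X : Type*} [AddCommGroup V] [AddCommGroup X]
  [Module (ZMod 2) V] [Module (ZMod 2) X] [Fintype X]

/-- If a linear map to a product rarely has heavy points, then it rarely has a heavy translate of
the second factor. -/
lemma card_heavy_coset_mul_le (s : ℕ) [Fintype (V →ₗ[ZMod 2] X × (Fin s → ZMod 2))]
    (c : ℝ) (hc : 0 ≤ c) (hcard : (Fintype.card (X × (Fin s → ZMod 2)) : ℝ) ≤ c ^ 2 ^ s)
    (S : Finset V) (r : ℝ) :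
    ((univ.filter fun L : V →ₗ[ZMod 2] X × (Fin s → ZMod 2) =>
        ∃ x, ∀ y, r ≤ load L S (x, y)).card : ℝ) * Fintype.card (X × (Fin s → ZMod 2))
      ≤ 4 * c * ∑ L : V →ₗ[ZMod 2] X × (Fin s → ZMod 2),
          ((univ.filter fun w => r ≤ load L S w).card : ℝ) := by
  have : Finite ((X × (Fin s → ZMod 2)) ≃ₗ[ZMod 2] (X × (Fin s → ZMod 2))) := DFunLike.finite _
  have := Fintype.ofFinite ((X × (Fin s → ZMod 2)) ≃ₗ[ZMod 2] (X × (Fin s → ZMod 2)))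
  set G : ℝ := (Fintype.card ((X × (Fin s → ZMod 2)) ≃ₗ[ZMod 2] (X × (Fin s → ZMod 2))) : ℝ)
    with hG
  have hG0 : 0 < G := by
    rw [hG]
    exact_mod_cast Fintype.card_pos_iff.2 ⟨LinearEquiv.refl _ _⟩
  let P : (V →ₗ[ZMod 2] X × (Fin s → ZMod 2)) → Prop := fun L => ∃ x, ∀ y, r ≤ load L S (x, y)
  have hload : ∀ (g : (X × (Fin s → ZMod 2)) ≃ₗ[ZMod 2] (X × (Fin s → ZMod 2)))
      (L : V →ₗ[ZMod 2] X × (Fin s → ZMod 2)) (w : X × (Fin s → ZMod 2)),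
      load (g.toLinearMap ∘ₗ L) S w = load L S (g.symm w) := by
    intro g L w
    unfold load
    congr 3
    ext a
    exact (LinearEquiv.eq_symm_apply g).symm
  -- Composition with `g` permutes the linear maps, so `L` may be replaced by `g ∘ L` and the
  -- average taken over `g` with `L` fixed.
  have hinv : ∀ g : (X × (Fin s → ZMod 2)) ≃ₗ[ZMod 2] (X × (Fin s → ZMod 2)),
      (∑ L : V →ₗ[ZMod 2] X × (Fin s → ZMod 2),
        if P (g.toLinearMap ∘ₗ L) then (1 : ℝ) else 0) = ((univ.filter P).card : ℝ) := by
    intro g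
    rw [Fintype.sum_equiv (LinearEquiv.congrRight (M := V) g).toEquiv
      (fun L => if P (g.toLinearMap ∘ₗ L) then (1 : ℝ) else 0)
      (fun L => if P L then (1 : ℝ) else 0) fun _ => rfl]
    exact sum_boole _ _
  have hdouble : ((univ.filter P).card : ℝ) * G =
      ∑ L, ((univ.filter fun g : (X × (Fin s → ZMod 2)) ≃ₗ[ZMod 2] (X × (Fin s → ZMod 2)) =>
        P (g.toLinearMap ∘ₗ L)).card : ℝ) := by
    rw [mul_comm, hG, ← card_univ, ← nsmul_eq_mul, ← sum_const,
      ← sum_congr rfl fun g _ => hinv g, sum_comm]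
    exact sum_congr rfl fun L _ => sum_boole _ _
  refine le_of_mul_le_mul_right ?_ hG0
  change ((univ.filter P).card : ℝ) * _ * G ≤ _
  rw [mul_right_comm, hdouble, sum_mul, mul_sum, sum_mul]
  refine sum_le_sum fun L _ => ?_
  refine le_trans (le_of_eq ?_) ((card_equiv_coset_subset_mul_le s c hc hcard
    (univ.filter fun w => r ≤ load L S w)).trans (le_of_eq ?_))
  · congr 3
    ext g
    simp only [P, hload, mem_filter, mem_univ, true_and]
  · ring

/-- If a linear map `L` has an overloaded bucket, then for most `R` all points of that bucket
are heavy for `L.prod R`. -/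
lemma card_overloaded_mul_le (s : ℕ) [Fintype (V →ₗ[ZMod 2] X)]
    [Fintype (V →ₗ[ZMod 2] (Fin s → ZMod 2))]
    [Fintype (V →ₗ[ZMod 2] X × (Fin s → ZMod 2))] (S : Finset V) (K r : ℝ)
    (hK : 32 * (2 ^ s) ^ 2 ≤ K) (hr : 4 * r * 2 ^ s ≤ 3 * K) :
    ((univ.filter fun L : V →ₗ[ZMod 2] X => ∃ x, K < load L S x).card : ℝ)
        * Fintype.card (V →ₗ[ZMod 2] (Fin s → ZMod 2))
      ≤ 2 * ((univ.filter fun L : V →ₗ[ZMod 2] X × (Fin s → ZMod 2) =>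
        ∃ x, ∀ y, r ≤ load L S (x, y)).card : ℝ) := by
  set N : ℝ := (Fintype.card (V →ₗ[ZMod 2] (Fin s → ZMod 2)) : ℝ)
  have hq : (0 : ℝ) < 2 ^ s := by positivity
  have key : ∀ L ∈ univ.filter (fun L : V →ₗ[ZMod 2] X => ∃ x, K < load L S x),
      N ≤ 2 * ((univ.filter fun R : V →ₗ[ZMod 2] (Fin s → ZMod 2) =>
        ∃ x, ∀ y, r ≤ load (L.prod R) S (x, y)).card : ℝ) := by
    intro L hL
    obtain ⟨x, hx⟩ := (mem_filter.1 hL).2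
    let A := S.filter fun a => L a = x
    have hA : K < (A.card : ℝ) := hx
    have hload : ∀ (R : V →ₗ[ZMod 2] (Fin s → ZMod 2)) (y : Fin s → ZMod 2),
        load (L.prod R) S (x, y) = load R A y := by
      intro R y
      unfold load
      rw [filter_filter]
      congr 2
      ext a
      simp [LinearMap.prod_apply]
    -- By `hr`, a point with load below `r` has less than three quarters of the mean `|A| / 2^s`;
    -- hence the deviation of a quarter of the mean.
    have hcheb := sum_card_deviating_mul_sq_le
      (fun (R : V →ₗ[ZMod 2] (Fin s → ZMod 2)) => (R : V → Fin s → ZMod 2)) A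
      (card_linearMap_collision_le A) ((A.card : ℝ) / (4 * 2 ^ s))
    have hcY : (Fintype.card (Fin s → ZMod 2) : ℝ) = 2 ^ s := by simp [ZMod.card]
    rw [hcY] at hcheb
    have hbad : ((univ.filter fun R : V →ₗ[ZMod 2] (Fin s → ZMod 2) =>
        ¬ ∃ x, ∀ y, r ≤ load (L.prod R) S (x, y)).card : ℝ) ≤
        ∑ R : V →ₗ[ZMod 2] (Fin s → ZMod 2), ((univ.filter fun y : Fin s → ZMod 2 =>
          ((A.card : ℝ) / (4 * 2 ^ s)) ^ 2 ≤ (load R A y - (A.card : ℝ) / 2 ^ s) ^ 2).card : ℝ) := by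
      rw [card_filter, Nat.cast_sum]
      refine sum_le_sum fun R _ => ?_
      by_cases h : ∃ x, ∀ y, r ≤ load (L.prod R) S (x, y)
      · rw [if_neg (not_not.2 h), Nat.cast_zero]
        exact Nat.cast_nonneg _
      · rw [if_pos h, Nat.cast_le, Nat.one_le_iff_ne_zero, ← Nat.pos_iff_ne_zero, card_pos]
        push Not at h
        obtain ⟨y, hy⟩ := h x
        rw [hload] at hy
        refine ⟨y, mem_filter.2 ⟨mem_univ _, ?_⟩⟩
        have h1 : r ≤ 3 / 4 * ((A.card : ℝ) / 2 ^ s) := by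
          rw [← mul_div_assoc, le_div_iff₀ hq]
          linarith
        have h2 : (A.card : ℝ) / (4 * 2 ^ s) = 1 / 4 * ((A.card : ℝ) / 2 ^ s) := by
          field_simp
        rw [h2, ← neg_sq (load R A y - _)]
        refine pow_le_pow_left₀ (by positivity) ?_ 2
        linarith
    have hA0 : 0 < (A.card : ℝ) := lt_of_le_of_lt (by positivity) (hK.trans_lt hA)
    have hbad2 : 2 * ((univ.filter fun R : V →ₗ[ZMod 2] (Fin s → ZMod 2) =>
        ¬ ∃ x, ∀ y, r ≤ load (L.prod R) S (x, y)).card : ℝ) ≤ N := by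
      have h3 := (mul_le_mul_of_nonneg_right hbad
        (sq_nonneg ((A.card : ℝ) / (4 * 2 ^ s)))).trans hcheb
      set D : ℝ := ((univ.filter fun R : V →ₗ[ZMod 2] (Fin s → ZMod 2) =>
        ¬ ∃ x, ∀ y, r ≤ load (L.prod R) S (x, y)).card : ℝ)
      have hD : 0 ≤ D := Nat.cast_nonneg _
      -- This is where `32 * (2 ^ s) ^ 2` comes from: it makes the expected number of deviating
      -- points at most `1 / 2`.
      have h4 : 2 * (A.card : ℝ) ≤ ((A.card : ℝ) / (4 * 2 ^ s)) ^ 2 := by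
        rw [div_pow, le_div_iff₀ (by positivity)]
        nlinarith [mul_le_mul_of_nonneg_right (hK.trans hA.le) hA0.le]
      refine le_of_mul_le_mul_right ?_ hA0
      calc 2 * D * A.card = D * (2 * A.card) := by ring
        _ ≤ D * ((A.card : ℝ) / (4 * 2 ^ s)) ^ 2 := by gcongr
        _ ≤ _ := h3
    have hsplit : ((univ.filter fun R : V →ₗ[ZMod 2] (Fin s → ZMod 2) =>
        ∃ x, ∀ y, r ≤ load (L.prod R) S (x, y)).card : ℝ) +
        ((univ.filter fun R : V →ₗ[ZMod 2] (Fin s → ZMod 2) =>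
        ¬ ∃ x, ∀ y, r ≤ load (L.prod R) S (x, y)).card : ℝ) = N := by
      rw [← Nat.cast_add, card_filter_add_card_filter_not, card_univ]
    linarith
  have h1 := sum_le_sum key
  rw [sum_const, nsmul_eq_mul, ← mul_sum] at h1
  refine h1.trans (mul_le_mul_of_nonneg_left ?_ zero_le_two)
  rw [← Nat.cast_sum, ← card_sigma]
  refine Nat.cast_le.2 (card_le_card_of_injOn (fun p => p.1.prod p.2) ?_ ?_)
  · rintro ⟨L, R⟩ h
    simpa using (mem_filter.1 (mem_sigma.1 h).2).2
  · rintro ⟨L, R⟩ _ ⟨L', R'⟩ _ h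
    have h2 := (LinearMap.prodEquiv (R := ZMod 2) (M := V) (M₂ := X) (M₃ := Fin s → ZMod 2)
      (ZMod 2)).injective (a₁ := (L, R)) (a₂ := (L', R')) h
    simp only [Prod.mk.injEq] at h2
    rw [h2.1, h2.2]

/-- The maximal load of a random linear map. -/
lemma card_overloaded_mul_sq_le (s : ℕ) [Fintype (V →ₗ[ZMod 2] X)] [Finite V] (S : Finset V)
    (K d : ℝ) (hcard : (Fintype.card X : ℝ) * 2 ^ s ≤ 2 ^ 2 ^ s)
    (hd : 0 < d) (hK : 32 * (2 ^ s) ^ 2 ≤ K)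
    (hr : 4 * ((S.card : ℝ) / (Fintype.card X * 2 ^ s) + d) * 2 ^ s ≤ 3 * K) :
    ((univ.filter fun L : V →ₗ[ZMod 2] X => ∃ x, K < load L S x).card : ℝ)
        * (Fintype.card X * 2 ^ s) * d ^ 2
      ≤ 16 * Fintype.card (V →ₗ[ZMod 2] X) * S.card := by
  have : Finite (V →ₗ[ZMod 2] (Fin s → ZMod 2)) := DFunLike.finite _
  have : Finite (V →ₗ[ZMod 2] X × (Fin s → ZMod 2)) := DFunLike.finite _
  have := Fintype.ofFinite (V →ₗ[ZMod 2] (Fin s → ZMod 2))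
  have := Fintype.ofFinite (V →ₗ[ZMod 2] X × (Fin s → ZMod 2))
  have hW : (Fintype.card (X × (Fin s → ZMod 2)) : ℝ) = Fintype.card X * 2 ^ s := by
    simp [ZMod.card]
  have h1 := card_overloaded_mul_le (X := X) s S K _ hK hr
  -- With `c = 2` the size condition is exactly `hcard`. The final 16 is 2 from choosing `R`, 4 from
  -- invertibility and 2 from `c`.
  have h2 := card_heavy_coset_mul_le (V := V) (X := X) s 2 zero_le_two (hW.trans_le hcard) S
    ((S.card : ℝ) / (Fintype.card X * 2 ^ s) + d)
  have h3 := sum_card_deviating_mul_sq_le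
    (fun (L : V →ₗ[ZMod 2] X × (Fin s → ZMod 2)) => (L : V → X × (Fin s → ZMod 2))) S
    (card_linearMap_collision_le S) d
  have h4 : Fintype.card (V →ₗ[ZMod 2] X × (Fin s → ZMod 2)) =
      Fintype.card (V →ₗ[ZMod 2] X) * Fintype.card (V →ₗ[ZMod 2] (Fin s → ZMod 2)) := by
    rw [← Fintype.card_prod]
    exact (Fintype.card_congr (LinearMap.prodEquiv (ZMod 2)).toEquiv).symm
  rw [hW] at h2 h3
  rw [h4, Nat.cast_mul] at h3
  have h5 : ∑ L : V →ₗ[ZMod 2] X × (Fin s → ZMod 2), ((univ.filter fun w =>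
      (S.card : ℝ) / (Fintype.card X * 2 ^ s) + d ≤ load L S w).card : ℝ) ≤
      ∑ L : V →ₗ[ZMod 2] X × (Fin s → ZMod 2), ((univ.filter fun w =>
      d ^ 2 ≤ (load L S w - (S.card : ℝ) / (Fintype.card X * 2 ^ s)) ^ 2).card : ℝ) := by
    refine sum_le_sum fun L _ => Nat.cast_le.2 (card_le_card fun w hw => ?_)
    simp only [mem_filter, mem_univ, true_and] at hw ⊢
    exact pow_le_pow_left₀ hd.le (by linarith) 2
  have hN : (0 : ℝ) < Fintype.card (V →ₗ[ZMod 2] (Fin s → ZMod 2)) := by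
    exact_mod_cast Fintype.card_pos
  refine le_of_mul_le_mul_right ?_ hN
  have hq : (0 : ℝ) ≤ Fintype.card X * 2 ^ s := by positivity
  have h6 := mul_le_mul_of_nonneg_right (mul_le_mul_of_nonneg_right h1 hq) (sq_nonneg d)
  have h7 := mul_le_mul_of_nonneg_right h2 (sq_nonneg d)
  have h8 := mul_le_mul_of_nonneg_right h5 (sq_nonneg d)
  linarith

end MaximalLoad

/-! ### From loads to distance from uniform -/

section CloseToUniform

open Finset

lemma hashedUniform_toReal {α β : Type*} [Fintype α] (S : Finset α) (hS : S.Nonempty)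
    (L : α → β) (y : β) : (hashedUniform S hS L y).toReal = load L S y / S.card := by
  classical
  have h : hashedUniform S hS L y =
      ((S.filter fun a => L a = y).card : ENNReal) * (S.card : ENNReal)⁻¹ := by
    rw [hashedUniform, PMF.map_apply, tsum_fintype, ← nsmul_eq_mul, ← sum_const, sum_filter,
      ← sum_subset (subset_univ S)]
    · refine sum_congr rfl fun a ha => ?_
      rw [PMF.uniformOfFinset_apply_of_mem hS ha]
      simp only [eq_comm]
    · intro a _ ha
      rw [PMF.uniformOfFinset_apply_of_notMem hS ha, ite_self]
  rw [h, ENNReal.toReal_mul, ENNReal.toReal_inv, ENNReal.toReal_natCast, ENNReal.toReal_natCast,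
    div_eq_mul_inv, load]

/-- If all buckets are bounded by `1 + τ` times their average, where `1 ≤ τ`, then the
distribution is close to uniform. -/
lemma closeToUniform_of_load_le {α β : Type*} [Fintype α] [Fintype β] [Nonempty β] (S : Finset α)
    (hS : S.Nonempty) (L : α → β) {τ : ℝ} (hτ : 1 ≤ τ)
    (h : ∀ y, load L S y ≤ (1 + τ) * S.card / Fintype.card β) :
    CloseToUniform (hashedUniform S hS L) (τ / Fintype.card β) := by
  intro y
  have hS0 : (0 : ℝ) < S.card := by exact_mod_cast hS.card_pos
  have hβ : (0 : ℝ) < Fintype.card β := by exact_mod_cast Fintype.card_pos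
  rw [hashedUniform_toReal, PMF.uniformOfFintype_apply, ENNReal.toReal_inv,
    ENNReal.toReal_natCast, abs_le]
  constructor
  -- Even an empty bucket deviates by only the uniform mass, which is at most `τ` times itself.
  · have h1 : 0 ≤ load L S y / S.card := div_nonneg (load_nonneg _ _ _) hS0.le
    have h2 : (Fintype.card β : ℝ)⁻¹ ≤ τ / Fintype.card β := by
      rw [inv_eq_one_div]
      gcongr
    linarith
  · have h1 : load L S y / S.card ≤ (1 + τ) / Fintype.card β := by
      rw [div_le_iff₀ hS0]
      exact (h y).trans (le_of_eq (by ring))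
    rw [add_div, one_div] at h1
    linarith

end CloseToUniform

/-! ### Choice of parameters and conclusion -/

open Classical in
/-- A quantitative form of the hashing theorem, for a given output length `t`. -/
lemma holdsForFraction_closeToUniform (n t s : ℕ) (S : Finset (Fin n → ZMod 2)) (hS : S.Nonempty)
    (δ τ M : ℝ) (hτ : 1 ≤ τ) (hM : 12 ≤ M) (hMs : (2 : ℝ) ^ s ≤ 2 * M)
    (hMt : 2 ^ t * M ^ 4 ≤ 2 * S.card) (hts : t + s ≤ 2 ^ s) (hδ : 512 ≤ δ * τ ^ 2 * M ^ 3) :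
    HoldsForFraction (1 - δ) (surjectiveMaps n t)
      (fun L => CloseToUniform (hashedUniform S hS L) (τ / 2 ^ t)) := by
  have : Finite ((Fin n → ZMod 2) →ₗ[ZMod 2] (Fin t → ZMod 2)) := DFunLike.finite _
  have := Fintype.ofFinite ((Fin n → ZMod 2) →ₗ[ZMod 2] (Fin t → ZMod 2))
  have hct : (Fintype.card (Fin t → ZMod 2) : ℝ) = 2 ^ t := by simp [ZMod.card]
  have hcn : (Fintype.card (Fin n → ZMod 2) : ℝ) = 2 ^ n := by simp [ZMod.card]
  have hT : (0 : ℝ) < 2 ^ t := by positivity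
  have hQ : (0 : ℝ) < 2 ^ s := by positivity
  have hS0 : (0 : ℝ) < S.card := by exact_mod_cast hS.card_pos
  have hM0 : (0 : ℝ) < M := by linarith
  set K : ℝ := (1 + τ) * S.card / 2 ^ t with hKdef
  have hlam : M ^ 4 ≤ K := by
    rw [hKdef, le_div_iff₀ hT]
    nlinarith
  have hK : 32 * (2 ^ s : ℝ) ^ 2 ≤ K := by
    refine le_trans ?_ hlam
    have h1 : ((2 : ℝ) ^ s) ^ 2 ≤ (2 * M) ^ 2 := pow_le_pow_left₀ hQ.le hMs 2
    have h2 : 144 ≤ M ^ 2 := by nlinarith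
    nlinarith
  -- Heavy now means `1 + τ / 2` times the mean; the condition on `K` becomes `4 + 2τ ≤ 3 + 3τ`,
  -- that is `1 ≤ τ`.
  have hover := card_overloaded_mul_sq_le (X := Fin t → ZMod 2) s S K
    (τ / 2 * (S.card / (2 ^ t * 2 ^ s)))
    (by rw [hct, ← pow_add]; exact pow_le_pow_right₀ one_le_two hts) (by positivity) hK
    (by
      rw [hct]
      have h1 : 4 * ((S.card : ℝ) / (2 ^ t * 2 ^ s) + τ / 2 * (S.card / (2 ^ t * 2 ^ s))) * 2 ^ s
          = (4 + 2 * τ) * S.card / 2 ^ t := by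
        field_simp
        ring
      rw [h1, hKdef, ← mul_div_assoc]
      refine div_le_div_of_nonneg_right ?_ hT.le
      nlinarith)
  rw [hct] at hover
  have hns : ((Finset.univ.filter fun L : (Fin n → ZMod 2) →ₗ[ZMod 2] (Fin t → ZMod 2) =>
      ¬ Function.Surjective L).card : ℝ) * Fintype.card (Fin n → ZMod 2) ≤
      Fintype.card (Fin t → ZMod 2) *
        Fintype.card ((Fin n → ZMod 2) →ₗ[ZMod 2] (Fin t → ZMod 2)) := by
    norm_cast
    convert card_not_surjective_mul_card_le (V := Fin n → ZMod 2) (X := Fin t → ZMod 2)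
  rw [hct, hcn] at hns
  have hSn : (S.card : ℝ) ≤ 2 ^ n := by
    rw [← hcn]
    exact_mod_cast Finset.card_le_univ S
  have hsplit : ((Finset.univ.filter fun L : (Fin n → ZMod 2) →ₗ[ZMod 2] (Fin t → ZMod 2) =>
      Function.Surjective L).card : ℝ) +
      ((Finset.univ.filter fun L : (Fin n → ZMod 2) →ₗ[ZMod 2] (Fin t → ZMod 2) =>
      ¬ Function.Surjective L).card : ℝ) =
      Fintype.card ((Fin n → ZMod 2) →ₗ[ZMod 2] (Fin t → ZMod 2)) := by
    rw [← Nat.cast_add, Finset.card_filter_add_card_filter_not, Finset.card_univ]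
  have hA : (surjectiveMaps n t).ncard =
      (Finset.univ.filter fun L : (Fin n → ZMod 2) →ₗ[ZMod 2] (Fin t → ZMod 2) =>
      Function.Surjective L).card := by
    rw [← Set.ncard_coe_finset]
    congr 1
    ext L
    simp [surjectiveMaps]
  have hE : (surjectiveMaps n t).ncard ≤
      {L ∈ surjectiveMaps n t | CloseToUniform (hashedUniform S hS L) (τ / 2 ^ t)}.ncard +
      (Finset.univ.filter fun L : (Fin n → ZMod 2) →ₗ[ZMod 2] (Fin t → ZMod 2) =>
        ∃ x, K < load L S x).card := by
    rw [← Set.ncard_coe_finset]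
    refine (Set.ncard_le_ncard ?_ (Set.toFinite _)).trans (Set.ncard_union_le _ _)
    intro L hL
    by_cases h : ∃ x, K < load L S x
    · exact Or.inr (by simpa using h)
    · push Not at h
      refine Or.inl ⟨hL, ?_⟩
      rw [← hct]
      refine closeToUniform_of_load_le S hS L hτ fun y => ?_
      rw [hct]
      exact h y
  replace hE := (Nat.cast_le (α := ℝ)).2 hE
  push_cast only [Nat.cast_add] at hE
  rw [HoldsForFraction]
  rw [← hA] at hsplit
  set Sj : ℝ := ((surjectiveMaps n t).ncard : ℝ)
  set D : ℝ := ((Finset.univ.filter fun L : (Fin n → ZMod 2) →ₗ[ZMod 2] (Fin t → ZMod 2) =>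
        ∃ x, K < load L S x).card : ℝ)
  set NS : ℝ := ((Finset.univ.filter fun L : (Fin n → ZMod 2) →ₗ[ZMod 2] (Fin t → ZMod 2) =>
      ¬ Function.Surjective L).card : ℝ)
  set N : ℝ := (Fintype.card ((Fin n → ZMod 2) →ₗ[ZMod 2] (Fin t → ZMod 2)) : ℝ)
  have hD0 : 0 ≤ D := Nat.cast_nonneg _
  have hNS0 : 0 ≤ NS := Nat.cast_nonneg _
  have hN0 : 0 ≤ N := Nat.cast_nonneg _
  have hM4 : 4 ≤ M ^ 4 := by
    have h1 : 144 ≤ M ^ 2 := by nlinarith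
    nlinarith
  -- Hence `N ≤ 2 * Sj`, which turns the bound `256 * N` below into `512 * Sj`.
  have hNS : 2 * NS ≤ N := by
    have h1 : 2 * (2 : ℝ) ^ t ≤ 2 ^ n := by nlinarith
    refine le_of_mul_le_mul_right ?_ hT
    have h2 := mul_le_mul_of_nonneg_left h1 hNS0
    linarith
  have h1 : D * τ ^ 2 * S.card ≤ 64 * N * 2 ^ t * 2 ^ s := by
    have h2 : D * (2 ^ t * 2 ^ s) * (τ / 2 * (S.card / (2 ^ t * 2 ^ s))) ^ 2 =
        D * τ ^ 2 * S.card * (S.card / (4 * 2 ^ t * 2 ^ s)) := by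
      field_simp
      ring
    rw [h2] at hover
    have h3 : (0 : ℝ) < S.card / (4 * 2 ^ t * 2 ^ s) := by positivity
    refine le_of_mul_le_mul_right (hover.trans (le_of_eq ?_)) h3
    field_simp
    ring
  have h2 : D * τ ^ 2 * M ^ 3 ≤ 256 * N := by
    have h3 : (0 : ℝ) < 2 ^ t * M := by positivity
    refine le_of_mul_le_mul_right ?_ h3
    calc D * τ ^ 2 * M ^ 3 * (2 ^ t * M) = D * τ ^ 2 * (2 ^ t * M ^ 4) := by ring
      _ ≤ D * τ ^ 2 * (2 * S.card) := by gcongr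
      _ = 2 * (D * τ ^ 2 * S.card) := by ring
      _ ≤ 2 * (64 * N * 2 ^ t * 2 ^ s) := by gcongr
      _ ≤ 2 * (64 * N * 2 ^ t * (2 * M)) := by gcongr
      _ = _ := by ring
  have h3 : D ≤ δ * Sj := by
    have h4 : (0 : ℝ) < τ ^ 2 * M ^ 3 := by positivity
    refine le_of_mul_le_mul_right ?_ h4
    have hSj : 0 ≤ Sj := Nat.cast_nonneg _
    calc D * (τ ^ 2 * M ^ 3) = D * τ ^ 2 * M ^ 3 := by ring
      _ ≤ 512 * Sj := by linarith
      _ ≤ (δ * τ ^ 2 * M ^ 3) * Sj := by gcongr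
      _ = _ := by ring
  linarith

theorem mainTheorem7 (n : ℕ) (S : Finset (Fin n → ZMod 2)) (hS : S.Nontrivial)
    (δ τ m : ℝ) (hδ_pos : 0 < δ) (hδ : δ ≤ 1 / 10) (hτ : 1 < τ)
    (hm : m = Real.logb 2 ((S.card : ℝ) * ((S.card : ℝ) - 1) / δ))
    (hcard : (S.card : ℝ) >
      m ^ 4 * max (2 ^ 8 * (1 + τ) ^ 4 / ((τ - Real.sqrt τ) * δ) ^ 8) 1)
    (hm_large : m ≥ 20 *
      ((⌈Real.logb 2 (m * max (4 * (1 + τ) / ((τ - Real.sqrt τ) * δ) ^ 2) 1)⌉ : ℤ) : ℝ)) :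
    ∃ t : ℕ, t ≤ n ∧
      (t : ℝ) ≥ Real.logb 2 (S.card : ℝ) -
        4 * Real.logb 2 (m * max (4 * (1 + τ) / ((τ - Real.sqrt τ) ^ 2 * δ ^ 2)) 1) ∧
      HoldsForFraction (1 - δ) (surjectiveMaps n t)
        (fun L => CloseToUniform (hashedUniform S hS.nonempty L) (τ / 2 ^ t)) := by
  rw [← mul_pow]
  set M : ℝ := m * max (4 * (1 + τ) / ((τ - Real.sqrt τ) * δ) ^ 2) 1 with hMdef
  have hτ0 : 0 < τ := by linarith
  have hsqrt : Real.sqrt τ < τ := by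
    rw [Real.sqrt_lt' hτ0]
    nlinarith
  have hsqrt0 : 0 < Real.sqrt τ := Real.sqrt_pos.2 hτ0
  set q : ℝ := τ - Real.sqrt τ
  have hq0 : 0 < q := sub_pos.2 hsqrt
  have hqτ : q ≤ τ := sub_le_self _ hsqrt0.le
  have hc2 : (2 : ℝ) ≤ S.card := by exact_mod_cast Finset.one_lt_card_iff_nontrivial.2 hS
  have hc0 : (0 : ℝ) < S.card := by linarith
  have hbig : (S.card : ℝ) * 10 ≤ (S.card : ℝ) * ((S.card : ℝ) - 1) / δ := by
    rw [le_div_iff₀ hδ_pos]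
    nlinarith
  have hm4 : 4 ≤ m := by
    rw [hm, Real.le_logb_iff_rpow_le one_lt_two (by linarith)]
    norm_num
    linarith
  have hlogS : Real.logb 2 S.card ≤ m := by
    rw [hm]
    exact Real.logb_le_logb_of_le one_lt_two hc0 (by linarith)
  have hmM : m ≤ M := le_mul_of_one_le_right (by linarith) (le_max_right _ _)
  have hM0 : 0 < M := by linarith
  have hlogM : 2 ≤ Real.logb 2 M := by
    rw [Real.le_logb_iff_rpow_le one_lt_two hM0]
    norm_num
    linarith
  -- The ceiling in `hm_large` is at least 2 by `hlogM`.
  have hm40 : 40 ≤ m := by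
    have := Int.le_ceil (Real.logb 2 M)
    linarith
  have hM4 : M ^ 4 ≤ S.card := by
    refine le_trans (le_of_eq ?_) hcard.le
    rw [hMdef, mul_pow, (pow_left_monotoneOn (n := 4)).map_max
      (Set.mem_ofPred.2 (by positivity)) (Set.mem_ofPred.2 zero_le_one), one_pow, div_pow, ← pow_mul]
    congr 3
    ring
  have hlogM4 : 4 * Real.logb 2 M ≤ Real.logb 2 S.card := by
    have := Real.logb_le_logb_of_le one_lt_two (by positivity) hM4
    rwa [Real.logb_pow] at this
  set t : ℕ := ⌈Real.logb 2 S.card - 4 * Real.logb 2 M⌉₊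
  set s : ℕ := ⌈Real.logb 2 M⌉₊
  have ht : (t : ℝ) < Real.logb 2 S.card - 4 * Real.logb 2 M + 1 :=
    Nat.ceil_lt_add_one (sub_nonneg.2 hlogM4)
  have hs : (s : ℝ) < Real.logb 2 M + 1 := Nat.ceil_lt_add_one (by linarith)
  have hs' : M ≤ 2 ^ s := by
    rw [← Real.rpow_natCast, ← Real.logb_le_iff_le_rpow one_lt_two hM0]
    exact Nat.le_ceil _
  have hMs : (2 : ℝ) ^ s ≤ 2 * M := by
    rw [← Real.rpow_natCast, ← Real.le_logb_iff_rpow_le one_lt_two (by positivity),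
      Real.logb_mul two_ne_zero hM0.ne', Real.logb_self_eq_one one_lt_two]
    linarith
  have hMt : (2 : ℝ) ^ t * M ^ 4 ≤ 2 * S.card := by
    rw [← le_div_iff₀ (by positivity), ← Real.rpow_natCast,
      ← Real.le_logb_iff_rpow_le one_lt_two (by positivity),
      Real.logb_div (by positivity) (by positivity), Real.logb_mul two_ne_zero hc0.ne',
      Real.logb_self_eq_one one_lt_two, Real.logb_pow]
    push_cast
    linarith
  refine ⟨t, ?_, Nat.le_ceil _, holdsForFraction_closeToUniform n t s S hS.nonempty δ τ M hτ.le
    (by linarith) hMs hMt ?_ ?_⟩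
  · have hSn : (S.card : ℝ) ≤ 2 ^ n := by
      exact_mod_cast (Finset.card_le_univ S).trans_eq (by simp [ZMod.card])
    have h1 : (2 : ℝ) ^ t ≤ 2 ^ n := by
      have h2 : 1 ≤ M ^ 2 := by nlinarith
      have h3 : 2 ≤ M ^ 4 := by nlinarith
      have h4 : (0 : ℝ) < 2 ^ t := by positivity
      nlinarith
    exact (pow_le_pow_iff_right₀ one_lt_two).1 h1
  -- The two ceilings add less than 2, and `3 * logb 2 M` exceeds that, so `t + s ≤ logb 2 |S| ≤ m ≤
  -- M ≤ 2 ^ s`.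
  · have h1 : (t : ℝ) + s ≤ 2 ^ s := by linarith
    exact_mod_cast h1
  · have h1 : 4 * m ≤ δ * τ * M := by
      have h2 : m * (4 * (1 + τ) / (q * δ) ^ 2) ≤ M :=
        mul_le_mul_of_nonneg_left (le_max_left _ _) (by linarith)
      rw [← mul_div_assoc, div_le_iff₀ (by positivity)] at h2
      -- From `q ≤ τ` and `δ ^ 2 ≤ δ`; one power of `δ` is given up so that `δ * τ * M` is bounded
      -- below with `δ` to the first power only.
      have h3 : (q * δ) ^ 2 ≤ τ * (δ * τ) := by
        rw [mul_pow]
        calc q ^ 2 * δ ^ 2 ≤ τ ^ 2 * δ := by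
              gcongr
              nlinarith
          _ = _ := by ring
      have h4 : M * (q * δ) ^ 2 ≤ M * (τ * (δ * τ)) := by gcongr
      refine le_of_mul_le_mul_right ?_ hτ0
      nlinarith
    have h2 : 160 ≤ δ * τ * M := by linarith
    calc (512 : ℝ) ≤ 160 * 1 * 40 ^ 2 := by norm_num
      _ ≤ (δ * τ * M) * τ * M ^ 2 := by
        gcongr
        linarith
      _ = _ := by ring
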